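/- Let $N\ge 1$, $n\ge 0$, and let agents $1,\dots,N$ communicate over a fixed connected undirected graph with symmetric weights $a_{ij}=a_{ji}$, $a_{ij}>0$ on edges and $a_{ij}=0$ otherwise. Let each cost $f_i:\mathbb{R}^n\to\mathbb{R}$ be continuously differentiable and strongly convex with $l$-Lipschitz gradient, let $d_1,\dots,d_N\in\mathbb{R}^n$, and let $X^*=\mathrm{col}(x_1^*,\dots,x_N^*)$ be an optimal solution of $$\min \sum_{i=1}^N f_i(x_i)\quad\text{s.t.}\quad \sum_{i=1}^N x_i=\sum_{i=1}^N d_i .$$ False data $u_i^a,\lambda_i^a,z_i^a:[0,\infty)\to\mathbb{R}^n$ are injected, and we put $\kappa_{i1}=u_i^a$, $\kappa_{i2}=-\sum_j a_{ij}(\lambda_i^a-\lambda_j^a)-\sum_j a_{ij}(z_i^a-z_j^a)$, $\kappa_{i3}=\sum_j a_{ij}(\lambda_i^a-\lambda_j^a)$. Agent $i$ has an unknown nonlinearity $g_i:\mathbb{R}^n\to\mathbb{R}^n$. Fix $a_1,a_2>0$ and, for a gain $w_0>0$, consider the resilient algorithm $$\begin{aligned}\dot x_i&=g_i(x_i)-\nabla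 f_i(x_i)-\lambda_i+\kappa_{i1}-\hat\kappa_{i1},\\ \dot\lambda_i&=-\sum_j a_{ij}(\lambda_i-\lambda_j)-\sum_j a_{ij}(z_i-z_j)+x_i-d_i+\kappa_{i2}-\hat\kappa_{i2},\\ \dot z_i&=\sum_j a_{ij}(\lambda_i-\lambda_j)+\kappa_{i3}-\hat\kappa_{i3}\end{aligned}$$ together with the linear extended state observer, for $\gamma_i=\mathrm{col}(x_i,\lambda_i,z_i)$ and $\hat\kappa_i=\mathrm{col}(\hat\kappa_{i1},\hat\kappa_{i2},\hat\kappa_{i3})$, $$\dot{\hat\gamma}_i=\hat\kappa_i+u_{io}+a_1w_0(\gamma_i-\hat\gamma_i),\qquad \dot{\hat\kappa}_i=a_2w_0^2(\gamma_i-\hat\gamma_i),$$ where $$u_{io}=\mathrm{col}\Bigl(-\nabla f_i(x_i)-\lambda_i-\hat\kappa_{i1},\ -\sum_j a_{ij}(\lambda_i-\lambda_j)-\sum_j a_{ij}(z_i-z_j)+x_i-d_i-\hat\kappa_{i2},\ \sum_j a_{ij}(\lambda_i-\lambda_j)-\hat\kappa_{i3}\Bigr).$$ (Here $\hat\kappa_{i1}$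 estimates the sum $\kappa_{i1}+g_i(x_i)$.) Then for every $M$ there is a constant $C>0$, depending only on $M$, the graph and its weights, the $f_i$, the $d_i$, $a_1$ and $a_2$, such that the following holds for every $w_0>0$, all $g_i$, all attacks and every solution of the closed loop on $[0,\infty)$, with arbitrary initial values. Suppose that $u_i^a,\lambda_i^a,z_i^a$ are bounded on $[0,\infty)$, and that the signals $u_i^a,\lambda_i^a,z_i^a$ and $t\mapsto g_i(x_i(t))$ are differentiable on $[0,\infty)$ with derivatives of norm at most $M$ for all sufficiently large $t$. Then $X=\mathrm{col}(x_1,\dots,x_N)$ satisfies $$\limsup_{t\to\infty}\|X(t)-X^*\|\le \frac{C}{w_0}.$$ That is, $\limsup_{t\to\infty}\|X(t)-X^*\|=O(1/w_0)$. -/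

import Mathlib

open Filter Topology
open scoped NNReal ENNReal

/-- The decision space `ℝⁿ` of one agent, with the Euclidean norm. -/
abbrev Vec (n : ℕ) : Type := EuclideanSpace ℝ (Fin n)

/-- Stacked vectors `col(v₁, …, v_N)` with `vᵢ ∈ ℝⁿ`, with the Euclidean norm of `ℝ^{Nn}`. -/
abbrev Stack (N n : ℕ) : Type := PiLp 2 (fun _ : Fin N => Vec n)

/-- A fixed undirected weighted graph on the agents that is connected;
`weight i j` is positive exactly on the edges. -/
structure CommGraph (N : ℕ) where
  graph : SimpleGraph (Fin N)
  connected : graph.Connected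
  weight : Fin N → Fin N → ℝ
  weight_symm : ∀ i j, weight i j = weight j i
  weight_pos : ∀ i j, graph.Adj i j → 0 < weight i j
  weight_zero : ∀ i j, ¬ graph.Adj i j → weight i j = 0

/-- The `i`-th block of `(L ⊗ Iₙ) v`, that is `∑ⱼ aᵢⱼ (vᵢ - vⱼ)`. -/
noncomputable def CommGraph.disagreement {N n : ℕ} (G : CommGraph N) (v : Stack N n)
    (i : Fin N) : Vec n :=
  ∑ j, G.weight i j • (v i - v j)

/-- Every cost is continuously differentiable and strongly convex,
with an `l`-Lipschitz gradient. -/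
def RegularCosts {N n : ℕ} (f : Fin N → Vec n → ℝ) (l : ℝ≥0) : Prop :=
  ∀ i, ContDiff ℝ 1 (f i) ∧ (∃ m : ℝ, 0 < m ∧ StrongConvexOn Set.univ m (f i)) ∧
    LipschitzWith l (gradient (f i))

/-- `Xs` minimizes `∑ᵢ fᵢ(xᵢ)` subject to `∑ᵢ xᵢ = ∑ᵢ dᵢ`. -/
def IsOptimalAllocation {N n : ℕ} (f : Fin N → Vec n → ℝ) (d Xs : Stack N n) : Prop :=
  ∑ i, Xs i = ∑ i, d i ∧
    ∀ Y : Stack N n, ∑ i, Y i = ∑ i, d i → ∑ i, f i (Xs i) ≤ ∑ i, f i (Y i)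

/-- False data injected in the actuators (`ua`) and in the sensed
multipliers and auxiliary states (`la`, `za`), as signals of time. -/
structure FDIAttack (N n : ℕ) where
  ua : ℝ → Stack N n
  la : ℝ → Stack N n
  za : ℝ → Stack N n

/-- Effect of the attack on the equation of `xᵢ`. -/
def FDIAttack.kappa1 {N n : ℕ} (A : FDIAttack N n) (i : Fin N) (t : ℝ) : Vec n :=
  A.ua t i

/-- Effect of the attack on the equation of `λᵢ`. -/
noncomputable def FDIAttack.kappa2 {N n : ℕ} (A : FDIAttack N n) (G : CommGraph N)
    (i : Fin N) (t : ℝ) : Vec n :=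
  -G.disagreement (A.la t) i - G.disagreement (A.za t) i

/-- Effect of the attack on the equation of `zᵢ`. -/
noncomputable def FDIAttack.kappa3 {N n : ℕ} (A : FDIAttack N n) (G : CommGraph N)
    (i : Fin N) (t : ℝ) : Vec n :=
  G.disagreement (A.la t) i

/-- A signal on `[0, ∞)` is bounded. -/
def BoundedSignal {n : ℕ} (φ : ℝ → Vec n) : Prop :=
  ∃ B : ℝ, ∀ t, 0 ≤ t → ‖φ t‖ ≤ B

/-- A signal is differentiable on `[0, ∞)` (one-sidedly at `0`), and its derivative is bounded
by `M` for all sufficiently large times. -/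
def RateBound {n : ℕ} (M : ℝ) (φ : ℝ → Vec n) : Prop :=
  DifferentiableOn ℝ φ (Set.Ici 0) ∧
    ∀ᶠ t in atTop, ‖derivWithin φ (Set.Ici 0) t‖ ≤ M

/-- All attack signals are bounded on `[0, ∞)` and differentiable there, with derivatives
ultimately bounded by `M`. -/
def FDIAttack.Admissible {N n : ℕ} (A : FDIAttack N n) (M : ℝ) : Prop :=
  ∀ i, (BoundedSignal (fun t => A.ua t i) ∧ RateBound M (fun t => A.ua t i)) ∧
    (BoundedSignal (fun t => A.la t i) ∧ RateBound M (fun t => A.la t i)) ∧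
    (BoundedSignal (fun t => A.za t i) ∧ RateBound M (fun t => A.za t i))

/-- The signals of the closed loop: the states `x, λ, z` of the agents, the observer states
`x̂, λ̂, ẑ` and the three blocks `k1, k2, k3` of `κ̂`. The block `k1 i` is the single observer
state that estimates the sum `κᵢ₁ + gᵢ(xᵢ)`. -/
structure LoopSignals (N n : ℕ) where
  x : ℝ → Stack N n
  lam : ℝ → Stack N n
  z : ℝ → Stack N n
  xh : ℝ → Stack N n
  lamh : ℝ → Stack N n
  zh : ℝ → Stack N n
  k1 : ℝ → Stack N n
  k2 : ℝ → Stack N n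
  k3 : ℝ → Stack N n

namespace LoopSignals

variable {N n : ℕ}

/-- First block of the known input of agent `i`. -/
noncomputable def input1 (S : LoopSignals N n) (f : Fin N → Vec n → ℝ) (i : Fin N) (t : ℝ) :
    Vec n :=
  -gradient (f i) (S.x t i) - S.lam t i - S.k1 t i

/-- Second block of the known input of agent `i`. -/
noncomputable def input2 (S : LoopSignals N n) (G : CommGraph N) (d : Stack N n)
    (i : Fin N) (t : ℝ) : Vec n :=
  -G.disagreement (S.lam t) i - G.disagreement (S.z t) i + S.x t i - d i - S.k2 t i

/-- Third block of the known input of agent `i`. -/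
noncomputable def input3 (S : LoopSignals N n) (G : CommGraph N) (i : Fin N) (t : ℝ) : Vec n :=
  G.disagreement (S.lam t) i - S.k3 t i

/-- The agents run the resilient algorithm under the attack `A`, on `[0, ∞)`. -/
def SolvesAlgorithm (S : LoopSignals N n) (G : CommGraph N) (f : Fin N → Vec n → ℝ)
    (d : Stack N n) (g : Fin N → Vec n → Vec n) (A : FDIAttack N n) : Prop :=
  ∀ i, ∀ t, 0 ≤ t →
    HasDerivWithinAt (fun s => S.x s i)
      (g i (S.x t i) + S.input1 f i t + A.kappa1 i t) (Set.Ici 0) t ∧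
    HasDerivWithinAt (fun s => S.lam s i)
      (S.input2 G d i t + A.kappa2 G i t) (Set.Ici 0) t ∧
    HasDerivWithinAt (fun s => S.z s i)
      (S.input3 G i t + A.kappa3 G i t) (Set.Ici 0) t

/-- The linear extended state observer with coefficients `a₁, a₂` and gains `w₀, w₀²`:
`γ̂' = κ̂ + uₒ + a₁ w₀ (γ - γ̂)` and `κ̂' = a₂ w₀² (γ - γ̂)`, on `[0, ∞)`. -/
def SolvesLinearESO (S : LoopSignals N n) (G : CommGraph N) (f : Fin N → Vec n → ℝ)
    (d : Stack N n) (a₁ a₂ w₀ : ℝ) : Prop :=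
  ∀ i, ∀ t, 0 ≤ t →
    HasDerivWithinAt (fun s => S.xh s i)
      (S.k1 t i + S.input1 f i t + a₁ • w₀ • (S.x t i - S.xh t i)) (Set.Ici 0) t ∧
    HasDerivWithinAt (fun s => S.lamh s i)
      (S.k2 t i + S.input2 G d i t + a₁ • w₀ • (S.lam t i - S.lamh t i)) (Set.Ici 0) t ∧
    HasDerivWithinAt (fun s => S.zh s i)
      (S.k3 t i + S.input3 G i t + a₁ • w₀ • (S.z t i - S.zh t i)) (Set.Ici 0) t ∧
    HasDerivWithinAt (fun s => S.k1 s i)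
      (a₂ • w₀ ^ 2 • (S.x t i - S.xh t i)) (Set.Ici 0) t ∧
    HasDerivWithinAt (fun s => S.k2 s i)
      (a₂ • w₀ ^ 2 • (S.lam t i - S.lamh t i)) (Set.Ici 0) t ∧
    HasDerivWithinAt (fun s => S.k3 s i)
      (a₂ • w₀ ^ 2 • (S.z t i - S.zh t i)) (Set.Ici 0) t

end LoopSignals

/-! The closed loop is a cascade. Let `ξ` be the lumped unknown input (attack plus `g`) minus its
estimate `κ̂`. Since the algorithm subtracts `κ̂`, it is the attack-free primal-dual flow perturbed
by exactly `ξ`. The known input cancels in the observer error, so `ξ` obeys a linear system driven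
only by the time derivative of the unknown input. The rate bounds hold along the trajectory, so no
small-gain argument between the two parts is needed.

Observer (`exists_observer_bound`): in the variables `(w₀ e, ξ)` the error system is stable with
rate of order `w₀`, so an input of size `H` leaves `ξ` ultimately of size `H / w₀`, with a factor
depending only on `a₁, a₂`.

Flow (`exists_primalDual_bound`): around the saddle point, a quadratic function with small cross
terms decays exponentially, so the final distance to the optimum is linear in the size of `ξ`.
Strong monotonicity damps only `x`; the cross terms carry the damping to `λ` and then to the part of
`z` orthogonal to `ker L`. Optimality says that the marginal costs agree, hence that the stacked
gradient lies in `ker L`; feasibility says that `X* - d` lies in its orthogonal complement.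

Both estimates come from `eventually_le_of_deriv_le_neg_mul_add`. They hold only for large times, so
initial values do not enter the constant. -/

/-- A scalar signal with `V' ≤ -α V + K` is ultimately bounded by `2 K / α`. -/
theorem eventually_le_of_deriv_le_neg_mul_add {V V' : ℝ → ℝ} {α K : ℝ} (hα : 0 < α) (hK : 0 < K)
    (hV : ∀ᶠ t in atTop, HasDerivAt V (V' t) t)
    (hle : ∀ᶠ t in atTop, V' t ≤ -α * V t + K) :
    ∀ᶠ t in atTop, V t ≤ 2 * K / α := by
  obtain ⟨T, hT⟩ := eventually_atTop.1 (hV.and hle)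
  -- Integrating factor: `exp (α s) * (V s - K / α)` is nonincreasing. The factor 2 in the
  -- conclusion leaves room `K / α` for the decaying remainder.
  have hd : ∀ t ∈ Set.Ici T, HasDerivAt (fun s => Real.exp (α * s) * (V s - K / α))
      (Real.exp (α * t) * (α * (V t - K / α) + V' t)) t := by
    intro t ht
    have h1 : HasDerivAt (fun s : ℝ => Real.exp (α * s)) (Real.exp (α * t) * α) t := by
      simpa using ((hasDerivAt_id t).const_mul α).exp
    convert! h1.mul ((hT t ht).1.sub_const (K / α)) using 1
    ring
  have hanti : AntitoneOn (fun s => Real.exp (α * s) * (V s - K / α)) (Set.Ici T) := by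
    refine antitoneOn_of_hasDerivWithinAt_nonpos (convex_Ici T)
      (fun t ht => (hd t ht).continuousAt.continuousWithinAt)
      (fun t ht => (hd t (interior_subset ht)).hasDerivWithinAt) (fun t ht => ?_)
    have h2 := (hT t (interior_subset ht)).2
    refine mul_nonpos_of_nonneg_of_nonpos (Real.exp_pos _).le ?_
    have : α * (K / α) = K := by field_simp
    nlinarith
  set c := Real.exp (α * T) * (V T - K / α) with hc
  have hlim : Tendsto (fun t : ℝ => c * Real.exp (-(α * t))) atTop (𝓝 (c * 0)) :=
    (Real.tendsto_exp_neg_atTop_nhds_zero.comp (tendsto_id.const_mul_atTop hα)).const_mul c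
  have hpos : c * 0 < K / α := by rw [mul_zero]; positivity
  filter_upwards [hlim.eventually (gt_mem_nhds hpos), eventually_ge_atTop T] with t h1 h2
  have h3 : Real.exp (α * t) * (V t - K / α) ≤ c := hanti Set.self_mem_Ici h2 h2
  have h4 : V t - K / α ≤ c * Real.exp (-(α * t)) := by
    have := mul_le_mul_of_nonneg_left h3 (Real.exp_pos (-(α * t))).le
    rw [← mul_assoc, ← Real.exp_add] at this
    simpa [mul_comm] using this
  have : 2 * K / α = K / α + K / α := by ring
  linarith

/-! ### Extended state observer -/

section Observer

/-- The weight of the cross term in the Lyapunov function of the observer error. -/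
theorem exists_observer_weight {a₁ a₂ : ℝ} (ha₁ : 0 < a₁) (ha₂ : 0 < a₂) :
    ∃ δ > 0, δ * (a₂ + a₁ ^ 2 / 2) ≤ a₁ * a₂ / 2 ∧ δ ≤ 1 ∧ δ ≤ a₂ / 4 := by
  refine ⟨min (a₁ * a₂ / 2 / (a₂ + a₁ ^ 2 / 2)) (min 1 (a₂ / 4)), by positivity, ?_,
    (min_le_right _ _).trans (min_le_left _ _), (min_le_right _ _).trans (min_le_right _ _)⟩
  rw [← le_div_iff₀ (by positivity)]
  exact min_le_left _ _

/-- The estimation error of the extended state observer is ultimately of order `H / w₀`. -/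
theorem exists_observer_bound {E : Type*} [NormedAddCommGroup E] [InnerProductSpace ℝ E]
    {a₁ a₂ : ℝ} (ha₁ : 0 < a₁) (ha₂ : 0 < a₂) :
    ∃ K > 0, ∀ (w H : ℝ) (e ξ h : ℝ → E), 0 < w → 0 < H →
      (∀ᶠ t in atTop, HasDerivAt e (ξ t - a₁ • w • e t) t) →
      (∀ᶠ t in atTop, HasDerivAt ξ (h t - a₂ • w ^ 2 • e t) t) →
      (∀ᶠ t in atTop, ‖h t‖ ≤ H) →
      ∀ᶠ t in atTop, ‖ξ t‖ ≤ K * H / w := by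
  obtain ⟨δ, hδ, hδ1, hδ2, hδ3⟩ := exists_observer_weight ha₁ ha₂
  set c := min (a₁ * a₂ / 2) (δ / 2) with hc
  have hc0 : 0 < c := by positivity
  set m := a₂ / 2 + 1 with hm
  have hm0 : 0 < m := by positivity
  refine ⟨4 * Real.sqrt m / c, by positivity, ?_⟩
  intro w H e ξ h hw hH he hξ hh
  have hα : 0 < w * c / (2 * m) := by positivity
  have hK : 0 < H ^ 2 / (w * c) := by positivity
  -- In terms of `w e` the error system is `w` times a fixed Hurwitz system plus the input. The
  -- negative cross term supplies the damping `-δ w ‖ξ‖²`, which the diagonal terms lack.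
  set V : ℝ → ℝ := fun t => a₂ / 2 * (w ^ 2 * inner ℝ (e t) (e t)) + 1 / 2 * inner ℝ (ξ t) (ξ t)
    - δ * (w * inner ℝ (e t) (ξ t)) with hVdef
  set V' : ℝ → ℝ := fun t => w * (-(a₁ * a₂ - δ * a₂) * (w ^ 2 * inner ℝ (e t) (e t))
    - δ * inner ℝ (ξ t) (ξ t) + δ * a₁ * (w * inner ℝ (e t) (ξ t)))
    + inner ℝ (ξ t) (h t) - δ * (w * inner ℝ (e t) (h t)) with hV'def
  have hbase : ∀ t, |inner ℝ (e t) (ξ t)| ≤ ‖e t‖ * ‖ξ t‖ := fun t => abs_real_inner_le_norm _ _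
  have hV : ∀ᶠ t in atTop, HasDerivAt V (V' t) t := by
    filter_upwards [he, hξ] with t h1 h2
    have := ((((h1.inner ℝ h1).const_mul (w ^ 2)).const_mul (a₂ / 2)).add
      ((h2.inner ℝ h2).const_mul (1 / 2))).sub (((h1.inner ℝ h2).const_mul w).const_mul δ)
    convert! this using 1
    simp only [hV'def, inner_sub_left, inner_sub_right, real_inner_smul_left,
      real_inner_smul_right, real_inner_comm (e t) (ξ t), real_inner_comm (ξ t) (h t)]
    ring
  have hle : ∀ᶠ t in atTop, V' t ≤ -(w * c / (2 * m)) * V t + H ^ 2 / (w * c) := by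
    filter_upwards [hh] with t h3
    have hx1 : inner ℝ (ξ t) (h t) ≤ ‖ξ t‖ * H :=
      (real_inner_le_norm _ _).trans (by gcongr)
    have hx2 : -(‖e t‖ * H) ≤ inner ℝ (e t) (h t) := by
      have := (abs_le.1 (abs_real_inner_le_norm (e t) (h t))).1
      have : ‖e t‖ * ‖h t‖ ≤ ‖e t‖ * H := by gcongr
      linarith
    simp only [hVdef, hV'def, real_inner_self_eq_norm_sq]
    set i := inner ℝ (e t) (ξ t)
    set p := w * ‖e t‖ with hp
    set q := ‖ξ t‖
    have hq0 : 0 ≤ q := norm_nonneg _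
    have hi : |w * i| ≤ p * q := by
      rw [abs_mul, abs_of_pos hw, hp, mul_assoc]
      exact mul_le_mul_of_nonneg_left (hbase t) hw.le
    have hi' := abs_le.1 hi
    have hp2 : w ^ 2 * ‖e t‖ ^ 2 = p ^ 2 := by rw [hp]; ring
    have hx2' : -δ * (w * inner ℝ (e t) (h t)) ≤ p * H := by
      have h4 : δ * (w * (‖e t‖ * H)) ≤ 1 * (w * (‖e t‖ * H)) := by gcongr
      have h5 : δ * (w * -(‖e t‖ * H)) ≤ δ * (w * inner ℝ (e t) (h t)) := by gcongr
      rw [hp]; linarith only [h4, h5]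
    rw [hp2]
    have hVle : a₂ / 2 * p ^ 2 + 1 / 2 * q ^ 2 - δ * (w * i) ≤ m * (p ^ 2 + q ^ 2) := by
      have : -(δ * (w * i)) ≤ 1 * (p * q) := by
        have h6 : δ * -(w * i) ≤ δ * (p * q) :=
          mul_le_mul_of_nonneg_left (by linarith) hδ.le
        have h7 : δ * (p * q) ≤ 1 * (p * q) := by gcongr
        linarith
      rw [hm]
      linarith only [this, mul_nonneg ha₂.le (sq_nonneg q), two_mul_le_add_sq p q,
        sq_nonneg p]
    have hdis : -(a₁ * a₂ - δ * a₂) * p ^ 2 - δ * q ^ 2 + δ * a₁ * (w * i)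
        ≤ -c * (p ^ 2 + q ^ 2) := by
      have hc1 : c ≤ a₁ * a₂ / 2 := min_le_left _ _
      have hc2 : c ≤ δ / 2 := min_le_right _ _
      have h8 : δ * a₁ * (w * i) ≤ δ * a₁ * (p * q) :=
        mul_le_mul_of_nonneg_left hi'.2 (by positivity)
      have h9 : δ * a₁ * (p * q) ≤ δ / 2 * q ^ 2 + δ * a₁ ^ 2 / 2 * p ^ 2 := by
        nlinarith [mul_nonneg hδ.le (sq_nonneg (q - a₁ * p))]
      have h10 : δ * (a₂ + a₁ ^ 2 / 2) * p ^ 2 ≤ a₁ * a₂ / 2 * p ^ 2 := by gcongr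
      have h11 : c * p ^ 2 ≤ a₁ * a₂ / 2 * p ^ 2 := by gcongr
      have h12 : c * q ^ 2 ≤ δ / 2 * q ^ 2 := by gcongr
      linarith
    -- Half of the dissipation `w * c` absorbs the input; the other half is the decay rate of `V`,
    -- through `V ≤ m (p² + q²)`.
    have hy : ∀ s : ℝ, s * H ≤ w * c / 2 * s ^ 2 + H ^ 2 / (w * c) / 2 := by
      intro s
      have : w * c / 2 * s ^ 2 + H ^ 2 / (w * c) / 2 - s * H = (w * c * s - H) ^ 2 / (2 * (w * c)) := by
        field_simp; ring
      have : 0 ≤ (w * c * s - H) ^ 2 / (2 * (w * c)) := by positivity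
      linarith
    have hyp := hy p
    have hyq := hy q
    have h13 : w * (-(a₁ * a₂ - δ * a₂) * p ^ 2 - δ * q ^ 2 + δ * a₁ * (w * i))
        ≤ w * (-c * (p ^ 2 + q ^ 2)) := by gcongr
    have h14 : w * c / (2 * m) * (a₂ / 2 * p ^ 2 + 1 / 2 * q ^ 2 - δ * (w * i))
        ≤ w * c / (2 * m) * (m * (p ^ 2 + q ^ 2)) := by gcongr
    have h15 : w * c / (2 * m) * (m * (p ^ 2 + q ^ 2)) = w * c / 2 * (p ^ 2 + q ^ 2) := by
      field_simp
    linarith only [hx1, hx2', hyp, hyq, h13, h14, h15]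
  filter_upwards [eventually_le_of_deriv_le_neg_mul_add hα hK hV hle] with t ht
  have hlow : 1 / 4 * ‖ξ t‖ ^ 2 ≤ V t := by
    simp only [hVdef, real_inner_self_eq_norm_sq]
    have h1 : δ * (w * inner ℝ (e t) (ξ t)) ≤ δ * (w * (‖e t‖ * ‖ξ t‖)) := by
      gcongr; exact real_inner_le_norm _ _
    have h2 : δ * (w * (‖e t‖ * ‖ξ t‖)) ≤ δ ^ 2 * (w * ‖e t‖) ^ 2 + 1 / 4 * ‖ξ t‖ ^ 2 := by
      nlinarith [sq_nonneg (δ * (w * ‖e t‖) - 1 / 2 * ‖ξ t‖)]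
    have h3 : δ ^ 2 * (w * ‖e t‖) ^ 2 ≤ a₂ / 2 * (w * ‖e t‖) ^ 2 := by
      gcongr; nlinarith
    linarith only [h1, h2, h3]
  have hfin : ‖ξ t‖ ^ 2 ≤ (4 * Real.sqrt m / c * H / w) ^ 2 := by
    have : (4 * Real.sqrt m / c * H / w) ^ 2 = 4 * (2 * (H ^ 2 / (w * c)) / (w * c / (2 * m))) := by
      rw [div_pow, mul_pow, div_pow, mul_pow, Real.sq_sqrt hm0.le]
      field_simp; norm_num
    linarith
  exact le_of_sq_le_sq hfin (by positivity)

end Observer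

/-! ### Perturbed primal-dual flow -/

section PrimalDual

/-- Weights of the cross terms in the Lyapunov function of the primal-dual flow. -/
theorem exists_primalDual_weights {μ l Λ σ : ℝ} (hμ : 0 < μ) (hl : 0 ≤ l) (hΛ : 0 < Λ)
    (hσ : 0 < σ) :
    ∃ ε₁ > 0, ∃ ε₂ > 0, ∃ ρ > 0, ε₁ ≤ 1 / 4 ∧ ε₂ ≤ 1 / 4 ∧ ∀ a c e : ℝ,
      -μ * a ^ 2 + ε₁ * (l * (a * c) - c ^ 2 + Λ * (a * c) + Λ * (a * e) + a ^ 2)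
        + ε₂ * (Λ * (c * e) - σ * e ^ 2 + a * e + Λ * c ^ 2) ≤ -ρ * (a ^ 2 + c ^ 2 + e ^ 2) := by
  -- The weights are `ε₁ = ε` and `ε₂ = ε κ`. The ratio `κ` is fixed first, so that the `c²` cost of
  -- the second cross term is at most a quarter of the gain from the first. Then `A` collects the
  -- whole `a²` cost, and `ε` is small enough for `μ` to pay for it.
  set κ := min 1 (1 / 4 / (Λ ^ 2 / σ + Λ)) with hκ
  have hκ0 : 0 < κ := by positivity
  have hκ1 : κ ≤ 1 := min_le_left _ _
  have hκ2 : κ * (Λ ^ 2 / σ + Λ) ≤ 1 / 4 := by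
    rw [← le_div_iff₀ (by positivity)]; exact min_le_right _ _
  set A := (l + Λ) ^ 2 + 1 + κ * ((Λ / κ + 1) ^ 2 / σ) with hA
  have hA0 : 0 < A := by positivity
  set ε := min (1 / 4) (μ / 2 / A) with hε
  have hε0 : 0 < ε := by positivity
  have hε1 : ε ≤ 1 / 4 := min_le_left _ _
  have hε2 : ε * A ≤ μ / 2 := by
    rw [← le_div_iff₀ (by positivity)]; exact min_le_right _ _
  set ρ := min (μ / 2) (min (ε / 2) (ε * κ * σ / 2)) with hρ
  have hρ0 : 0 < ρ := by positivity
  have hρ1 : ρ ≤ μ / 2 := min_le_left _ _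
  have hρ2 : ρ ≤ ε / 2 := (min_le_right _ _).trans (min_le_left _ _)
  have hρ3 : ρ ≤ ε * κ * σ / 2 := (min_le_right _ _).trans (min_le_right _ _)
  refine ⟨ε, hε0, ε * κ, by positivity, ρ, hρ0, hε1, by nlinarith, fun a c e => ?_⟩
  have y1 : Λ * (c * e) ≤ σ / 4 * e ^ 2 + Λ ^ 2 / σ * c ^ 2 := by
    have : σ / 4 * e ^ 2 + Λ ^ 2 / σ * c ^ 2 - Λ * (c * e) = (σ / 2 * e - Λ * c) ^ 2 / σ := by
      field_simp; ring
    have : 0 ≤ (σ / 2 * e - Λ * c) ^ 2 / σ := by positivity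
    linarith
  have y2 : (l + Λ) * (a * c) ≤ c ^ 2 / 4 + (l + Λ) ^ 2 * a ^ 2 := by
    nlinarith [sq_nonneg (c / 2 - (l + Λ) * a)]
  have y3 : (Λ / κ + 1) * (a * e) ≤ σ / 4 * e ^ 2 + (Λ / κ + 1) ^ 2 / σ * a ^ 2 := by
    have : σ / 4 * e ^ 2 + (Λ / κ + 1) ^ 2 / σ * a ^ 2 - (Λ / κ + 1) * (a * e)
        = (σ / 2 * e - (Λ / κ + 1) * a) ^ 2 / σ := by
      field_simp; ring
    have : 0 ≤ (σ / 2 * e - (Λ / κ + 1) * a) ^ 2 / σ := by positivity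
    linarith
  have z1 := mul_le_mul_of_nonneg_left y1 (mul_pos hε0 hκ0).le
  have z2 := mul_le_mul_of_nonneg_left y2 hε0.le
  have z3 := mul_le_mul_of_nonneg_left y3 (mul_pos hε0 hκ0).le
  have z3' : ε * κ * ((Λ / κ + 1) * (a * e)) = ε * (Λ * (a * e)) + ε * κ * (a * e) := by
    field_simp
  have z4 : ε * (κ * (Λ ^ 2 / σ + Λ)) * c ^ 2 ≤ ε * (1 / 4) * c ^ 2 := by gcongr
  have z5 : ε * A * a ^ 2 ≤ μ / 2 * a ^ 2 := by gcongr
  have z6 : ρ * a ^ 2 ≤ μ / 2 * a ^ 2 := by gcongr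
  have z7 : ρ * c ^ 2 ≤ ε / 2 * c ^ 2 := by gcongr
  have z8 : ρ * e ^ 2 ≤ ε * κ * σ / 2 * e ^ 2 := by gcongr
  rw [hA] at z5
  linarith

variable {E : Type*} [NormedAddCommGroup E] [InnerProductSpace ℝ E]

/-- Error dynamics of the primal-dual flow: ultimate bound by the size of the disturbances. -/
theorem exists_primalDual_error_bound (L : E →L[ℝ] E)
    (hsymm : ∀ v w, inner ℝ (L v) w = inner ℝ v (L w)) (hpos : ∀ v, 0 ≤ inner ℝ v (L v))
    {U : Submodule ℝ E} {σ : ℝ} (hσ : 0 < σ) (hU : ∀ v ∈ U, σ * ‖v‖ ^ 2 ≤ inner ℝ v (L v))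
    {μ l : ℝ} (hμ : 0 < μ) (hl : 0 ≤ l) :
    ∃ K > 0, ∀ (p q r u ξ₁ ξ₂ ξ₃ : ℝ → E) (b : ℝ), 0 < b →
      (∀ t, r t ∈ U) →
      (∀ t, μ * ‖p t‖ ^ 2 ≤ inner ℝ (p t) (u t)) → (∀ t, ‖u t‖ ≤ l * ‖p t‖) →
      (∀ᶠ t in atTop, HasDerivAt p (-u t - q t + ξ₁ t) t) →
      (∀ᶠ t in atTop, HasDerivAt q (-L (q t) - L (r t) + p t + ξ₂ t) t) →
      (∀ᶠ t in atTop, HasDerivAt r (L (q t) + ξ₃ t) t) →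
      (∀ᶠ t in atTop, ‖ξ₁ t‖ ≤ b ∧ ‖ξ₂ t‖ ≤ b ∧ ‖ξ₃ t‖ ≤ b) →
      ∀ᶠ t in atTop, ‖p t‖ ≤ K * b := by
  set Λ := ‖L‖ + 1 with hΛ
  have hΛ0 : 0 < Λ := by positivity
  have hL : ∀ v w : E, |inner ℝ v (L w)| ≤ Λ * (‖v‖ * ‖w‖) := fun v w => by
    have h1 := abs_real_inner_le_norm v (L w)
    have h2 : ‖v‖ * ‖L w‖ ≤ ‖v‖ * (Λ * ‖w‖) := by
      gcongr
      exact (L.le_opNorm w).trans (by gcongr; linarith)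
    linarith
  obtain ⟨ε₁, hε₁, ε₂, hε₂, ρ, hρ, hε₁', hε₂', hquad⟩ := exists_primalDual_weights hμ hl hΛ0 hσ
  -- The estimates below give `‖p‖² ≤ 4 * 108 * b² / ρ²`, and `432 ≤ 21²`.
  refine ⟨21 / ρ, by positivity, ?_⟩
  intro p q r u ξ₁ ξ₂ ξ₃ b hb hr hmono hlip hp hq hrd hξ
  set V : ℝ → ℝ := fun t => 1 / 2 * (inner ℝ (p t) (p t) + inner ℝ (q t) (q t)
    + inner ℝ (r t) (r t)) + ε₁ * inner ℝ (p t) (q t) + ε₂ * inner ℝ (q t) (r t) with hVdef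
  set V' : ℝ → ℝ := fun t => -inner ℝ (p t) (u t) - inner ℝ (q t) (L (q t))
    + inner ℝ (p t) (ξ₁ t) + inner ℝ (q t) (ξ₂ t) + inner ℝ (r t) (ξ₃ t)
    + ε₁ * (-inner ℝ (q t) (u t) - inner ℝ (q t) (q t) + inner ℝ (q t) (ξ₁ t)
      - inner ℝ (p t) (L (q t)) - inner ℝ (p t) (L (r t)) + inner ℝ (p t) (p t)
      + inner ℝ (p t) (ξ₂ t))
    + ε₂ * (-inner ℝ (r t) (L (q t)) - inner ℝ (r t) (L (r t)) + inner ℝ (p t) (r t)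
      + inner ℝ (r t) (ξ₂ t) + inner ℝ (q t) (L (q t)) + inner ℝ (q t) (ξ₃ t)) with hV'def
  have hV : ∀ᶠ t in atTop, HasDerivAt V (V' t) t := by
    filter_upwards [hp, hq, hrd] with t h1 h2 h3
    have := (((((h1.inner ℝ h1).add (h2.inner ℝ h2)).add (h3.inner ℝ h3)).const_mul (1 / 2)).add
      ((h1.inner ℝ h2).const_mul ε₁)).add ((h2.inner ℝ h3).const_mul ε₂)
    convert! this using 1
    have e1 : inner ℝ (q t) (L (r t)) = inner ℝ (r t) (L (q t)) := by
      rw [← hsymm, real_inner_comm]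
    simp only [hV'def, inner_add_left, inner_add_right, inner_sub_left, inner_sub_right,
      inner_neg_left, inner_neg_right, hsymm, real_inner_comm (p t) (u t),
      real_inner_comm (q t) (u t), real_inner_comm (p t) (q t), real_inner_comm (p t) (ξ₁ t),
      real_inner_comm (q t) (ξ₁ t), real_inner_comm (q t) (ξ₂ t), real_inner_comm (r t) (ξ₂ t),
      real_inner_comm (r t) (ξ₃ t), e1]
    ring
  have hV'le : ∀ᶠ t in atTop, V' t ≤ -(ρ / 4) * V t + 27 * b ^ 2 / (2 * ρ) := by
    filter_upwards [hξ] with t ⟨g1, g2, g3⟩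
    have hin : ∀ v ξ : E, ‖ξ‖ ≤ b → inner ℝ v ξ ≤ ‖v‖ * b := fun v ξ h =>
      (real_inner_le_norm _ _).trans (by gcongr)
    have s1 := hmono t
    have s2 := hpos (q t)
    have s3 := hU (r t) (hr t)
    have s4 : -inner ℝ (q t) (u t) ≤ l * (‖p t‖ * ‖q t‖) := by
      have h1 := (abs_le.1 (abs_real_inner_le_norm (q t) (u t))).1
      have h2 : ‖q t‖ * ‖u t‖ ≤ ‖q t‖ * (l * ‖p t‖) := by gcongr; exact hlip t
      linarith
    have s5 := (abs_le.1 (hL (p t) (q t))).1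
    have s6 := (abs_le.1 (hL (p t) (r t))).1
    have s7 := (abs_le.1 (hL (r t) (q t))).1
    have s8 := (abs_le.1 (hL (q t) (q t))).2
    have s9 := real_inner_le_norm (p t) (r t)
    have t1 := hin (p t) _ g1
    have t2 := hin (q t) _ g1
    have t3 := hin (p t) _ g2
    have t4 := hin (q t) _ g2
    have t5 := hin (r t) _ g2
    have t6 := hin (q t) _ g3
    have t7 := hin (r t) _ g3
    have v1 := real_inner_le_norm (p t) (q t)
    have v2 := real_inner_le_norm (q t) (r t)
    simp only [hVdef, hV'def, real_inner_self_eq_norm_sq]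
    have hq2 := hquad ‖p t‖ ‖q t‖ ‖r t‖
    set a := ‖p t‖
    set c := ‖q t‖
    set e := ‖r t‖
    have ha : 0 ≤ a := norm_nonneg _
    have hc : 0 ≤ c := norm_nonneg _
    have he : 0 ≤ e := norm_nonneg _
    have w1 : -inner ℝ (q t) (u t) - c ^ 2 + inner ℝ (q t) (ξ₁ t)
      - inner ℝ (p t) (L (q t)) - inner ℝ (p t) (L (r t)) + a ^ 2 + inner ℝ (p t) (ξ₂ t) ≤
      (l * (a * c) - c ^ 2 + Λ * (a * c) + Λ * (a * e) + a ^ 2) + (a * b + c * b) := by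
      linarith only [s4, s5, s6, t2, t3]
    have w2 : -inner ℝ (r t) (L (q t)) - inner ℝ (r t) (L (r t)) + inner ℝ (p t) (r t)
      + inner ℝ (r t) (ξ₂ t) + inner ℝ (q t) (L (q t)) + inner ℝ (q t) (ξ₃ t) ≤
      (Λ * (c * e) - σ * e ^ 2 + a * e + Λ * c ^ 2) + (e * b + c * b) := by
      linarith only [s7, s3, s9, t5, s8, t6]
    have w1' := mul_le_mul_of_nonneg_left w1 hε₁.le
    have w2' := mul_le_mul_of_nonneg_left w2 hε₂.le
    have w3 : ε₁ * (a * b + c * b) ≤ 1 * (a * b + c * b) := by gcongr; linarith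
    have w4 : ε₂ * (e * b + c * b) ≤ 1 * (e * b + c * b) := by gcongr; linarith
    have hab : 0 ≤ a * b := by positivity
    have hcb : 0 ≤ c * b := by positivity
    have heb : 0 ≤ e * b := by positivity
    -- Each of `a, c, e` meets a disturbance at most three times. Half of `ρ` is spent here; with `V
    -- ≤ 2 (a² + c² + e²)` the rest gives the rate `ρ / 4`.
    have hy : ∀ s : ℝ, 3 * (s * b) ≤ ρ / 2 * s ^ 2 + 9 * b ^ 2 / (2 * ρ) := by
      intro s
      have : ρ / 2 * s ^ 2 + 9 * b ^ 2 / (2 * ρ) - 3 * (s * b) = (ρ * s - 3 * b) ^ 2 / (2 * ρ) := by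
        field_simp; ring
      have : 0 ≤ (ρ * s - 3 * b) ^ 2 / (2 * ρ) := by positivity
      linarith
    have hya := hy a
    have hyc := hy c
    have hye := hy e
    have x1 : ε₁ * inner ℝ (p t) (q t) ≤ 1 / 4 * (a * c) :=
      (mul_le_mul_of_nonneg_left v1 hε₁.le).trans (by gcongr)
    have x2 : ε₂ * inner ℝ (q t) (r t) ≤ 1 / 4 * (c * e) :=
      (mul_le_mul_of_nonneg_left v2 hε₂.le).trans (by gcongr)
    have x3 : 1 / 2 * (a ^ 2 + c ^ 2 + e ^ 2) + ε₁ * inner ℝ (p t) (q t)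
        + ε₂ * inner ℝ (q t) (r t) ≤ 2 * (a ^ 2 + c ^ 2 + e ^ 2) := by
      linarith only [x1, x2, two_mul_le_add_sq a c, two_mul_le_add_sq c e, sq_nonneg a,
        sq_nonneg c, sq_nonneg e]
    have x4 : ρ / 4 * (1 / 2 * (a ^ 2 + c ^ 2 + e ^ 2) + ε₁ * inner ℝ (p t) (q t)
        + ε₂ * inner ℝ (q t) (r t)) ≤ ρ / 4 * (2 * (a ^ 2 + c ^ 2 + e ^ 2)) := by gcongr
    have x5 : 27 * b ^ 2 / (2 * ρ) = 3 * (9 * b ^ 2 / (2 * ρ)) := by ring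
    rw [x5]
    linarith only [s1, s2, t1, t4, t7, w1', w2', w3, w4, hq2, hya, hyc, hye, x4, hab, hcb, heb]
  filter_upwards [eventually_le_of_deriv_le_neg_mul_add (by positivity) (by positivity) hV hV'le]
    with t ht
  have hlow : 1 / 4 * ‖p t‖ ^ 2 ≤ V t := by
    simp only [hVdef, real_inner_self_eq_norm_sq]
    have v1 := (abs_le.1 (abs_real_inner_le_norm (p t) (q t))).1
    have v2 := (abs_le.1 (abs_real_inner_le_norm (q t) (r t))).1
    have x1 : -(ε₁ * inner ℝ (p t) (q t)) ≤ 1 / 4 * (‖p t‖ * ‖q t‖) := by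
      have h1 : ε₁ * -inner ℝ (p t) (q t) ≤ ε₁ * (‖p t‖ * ‖q t‖) := by gcongr; linarith
      have h2 : ε₁ * (‖p t‖ * ‖q t‖) ≤ 1 / 4 * (‖p t‖ * ‖q t‖) := by gcongr
      linarith
    have x2 : -(ε₂ * inner ℝ (q t) (r t)) ≤ 1 / 4 * (‖q t‖ * ‖r t‖) := by
      have h1 : ε₂ * -inner ℝ (q t) (r t) ≤ ε₂ * (‖q t‖ * ‖r t‖) := by gcongr; linarith
      have h2 : ε₂ * (‖q t‖ * ‖r t‖) ≤ 1 / 4 * (‖q t‖ * ‖r t‖) := by gcongr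
      linarith
    linarith only [x1, x2, two_mul_le_add_sq ‖p t‖ ‖q t‖, two_mul_le_add_sq ‖q t‖ ‖r t‖,
      sq_nonneg ‖p t‖, sq_nonneg ‖q t‖, sq_nonneg ‖r t‖]
  have hfin : ‖p t‖ ^ 2 ≤ (21 / ρ * b) ^ 2 := by
    have h1 : (21 / ρ * b) ^ 2 = 441 * (b ^ 2 / ρ ^ 2) := by ring
    have h2 : 2 * (27 * b ^ 2 / (2 * ρ)) / (ρ / 4) = 108 * (b ^ 2 / ρ ^ 2) := by
      field_simp; norm_num
    have : 0 ≤ b ^ 2 / ρ ^ 2 := by positivity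
    linarith
  exact le_of_sq_le_sq hfin (by positivity)

/-- A symmetric positive semidefinite operator is coercive on the complement of its kernel. -/
theorem exists_coercive_on_orthogonal_ker [FiniteDimensional ℝ E] (L : E →L[ℝ] E)
    (hpos : ∀ v, 0 ≤ inner ℝ v (L v)) (hker : ∀ v, inner ℝ v (L v) = 0 → L v = 0) :
    ∃ σ > 0, ∀ v ∈ L.kerᗮ, σ * ‖v‖ ^ 2 ≤ inner ℝ v (L v) := by
  have hcomp : IsCompact (Metric.sphere (0 : E) 1 ∩ (L.kerᗮ : Submodule ℝ E)) :=
    (isCompact_sphere 0 1).inter_right (Submodule.closed_of_finiteDimensional _)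
  have hcont : ContinuousOn (fun v : E => (inner ℝ v (L v) : ℝ))
      (Metric.sphere (0 : E) 1 ∩ (L.kerᗮ : Submodule ℝ E)) := by fun_prop
  have hunit : ∃ σ > 0, ∀ v ∈ Metric.sphere (0 : E) 1 ∩ (L.kerᗮ : Submodule ℝ E),
      σ ≤ (inner ℝ v (L v) : ℝ) := by
    -- This also covers an empty set, which occurs when the complement of the kernel is trivial, as
    -- for a single agent.
    refine hcomp.exists_forall_le' hcont (a := 0) fun v hv => ?_
    refine lt_of_le_of_ne (hpos v) fun h0 => ?_
    have h1 : v ∈ L.ker := hker v h0.symm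
    have h2 : inner ℝ v v = (0 : ℝ) := hv.2 v h1
    rw [inner_self_eq_zero] at h2
    simp [h2] at hv
  obtain ⟨σ, hσ, h⟩ := hunit
  refine ⟨σ, hσ, fun v hv => ?_⟩
  rcases eq_or_ne v 0 with rfl | hv0
  · simp
  have hn : 0 < ‖v‖ := norm_pos_iff.2 hv0
  have h1 := h (‖v‖⁻¹ • v) ⟨by simp [norm_smul, hn.ne'], Submodule.smul_mem _ _ hv⟩
  rw [map_smul, real_inner_smul_left, real_inner_smul_right] at h1
  have h2 := mul_le_mul_of_nonneg_right h1 (sq_nonneg ‖v‖)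
  have h3 : ‖v‖⁻¹ * (‖v‖⁻¹ * inner ℝ v (L v)) * ‖v‖ ^ 2 = inner ℝ v (L v) := by
    field_simp
  linarith

/-- The perturbed primal-dual flow ends up near the saddle point,
at a distance proportional to the size of the disturbances. -/
theorem exists_primalDual_bound [FiniteDimensional ℝ E] (L : E →L[ℝ] E)
    (hsymm : ∀ v w, inner ℝ (L v) w = inner ℝ v (L w)) (hpos : ∀ v, 0 ≤ inner ℝ v (L v))
    (hker : ∀ v, inner ℝ v (L v) = 0 → L v = 0)
    {μ l : ℝ} (hμ : 0 < μ) (hl : 0 ≤ l) (F : E → E) (xs d : E)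
    (hmono : ∀ x, μ * ‖x - xs‖ ^ 2 ≤ inner ℝ (x - xs) (F x - F xs))
    (hlip : ∀ x, ‖F x - F xs‖ ≤ l * ‖x - xs‖)
    (hF : L (F xs) = 0) (hd : xs - d ∈ L.kerᗮ) :
    ∃ K > 0, ∀ (x lam z ξ₁ ξ₂ ξ₃ : ℝ → E) (b : ℝ), 0 < b →
      (∀ᶠ t in atTop, HasDerivAt x (-F (x t) - lam t + ξ₁ t) t) →
      (∀ᶠ t in atTop, HasDerivAt lam (-L (lam t) - L (z t) + x t - d + ξ₂ t) t) →
      (∀ᶠ t in atTop, HasDerivAt z (L (lam t) + ξ₃ t) t) →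
      (∀ᶠ t in atTop, ‖ξ₁ t‖ ≤ b ∧ ‖ξ₂ t‖ ≤ b ∧ ‖ξ₃ t‖ ≤ b) →
      ∀ᶠ t in atTop, ‖x t - xs‖ ≤ K * b := by
  obtain ⟨σ, hσ, hU⟩ := exists_coercive_on_orthogonal_ker L hpos hker
  obtain ⟨K, hK, H⟩ := exists_primalDual_error_bound L hsymm hpos hσ hU hμ hl
  have hS : (L : E →ₗ[ℝ] E).IsSymmetric := hsymm
  obtain ⟨zs, hzs⟩ : ∃ zs, L zs = xs - d := by
    have h1 : L.kerᗮ = L.range := by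
      rw [← hS.orthogonal_range, Submodule.orthogonal_orthogonal]
    rw [h1] at hd
    exact hd
  -- The component of `z` in `ker L` may drift under `ξ₃`, but it never acts on `x` or `λ`. Only the
  -- projection of `z - zs` is tracked; the equilibrium multiplier is `-F xs`.
  set P := (L.kerᗮ).starProjection with hP
  have hPL : ∀ v, P (L v) = L v := fun v => by
    refine Submodule.starProjection_eq_self_iff.2 ?_
    intro w hw
    have hw' : L w = 0 := hw
    rw [← hsymm, hw', inner_zero_left]
  have hLP : ∀ v, L (P v) = L v := fun v => by
    have h1 := Submodule.sub_starProjection_mem_orthogonal (K := L.kerᗮ) v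
    rw [Submodule.orthogonal_orthogonal] at h1
    have h2 : L (v - P v) = 0 := h1
    rw [map_sub, sub_eq_zero] at h2
    exact h2.symm
  refine ⟨K, hK, fun x lam z ξ₁ ξ₂ ξ₃ b hb hx hlam hz hξ => ?_⟩
  refine H (fun t => x t - xs) (fun t => lam t + F xs) (fun t => P (z t - zs))
    (fun t => F (x t) - F xs) ξ₁ ξ₂ (fun t => P (ξ₃ t)) b hb
    (fun t => Submodule.starProjection_apply_mem _ _) (fun t => hmono _) (fun t => hlip _)
    ?_ ?_ ?_ ?_
  · filter_upwards [hx] with t h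
    convert! h.sub_const xs using 1
    abel
  · filter_upwards [hlam] with t h
    convert! h.add_const (F xs) using 1
    rw [hLP, map_add, hF, map_sub, hzs]
    abel
  · filter_upwards [hz] with t h
    convert! P.hasFDerivAt.comp_hasDerivAt t (h.sub_const zs) using 1
    rw [map_add, hF, add_zero, map_add, hPL]
  · filter_upwards [hξ] with t ⟨h1, h2, h3⟩
    exact ⟨h1, h2, (Submodule.norm_starProjection_apply_le _ _).trans h3⟩

end PrimalDual

section Instances

variable {N n : ℕ}

/-- Shortcut: the module structure on stacked vectors, found through the norm. -/
noncomputable local instance Stack.module : Module ℝ (Stack N n) := NormedSpace.toModule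

/-- Shortcut: scalar multiplication on stacked vectors is continuous. -/
local instance Stack.continuousSMul : ContinuousSMul ℝ (Stack N n) := IsBoundedSMul.continuousSMul

/-! ### Graph Laplacian -/

section Laplacian

/-- The operator `L ⊗ Iₙ` of a weighted graph. -/
noncomputable def CommGraph.laplacian (G : CommGraph N) (n : ℕ) : Stack N n →L[ℝ] Stack N n :=
  LinearMap.toContinuousLinearMap
    { toFun := fun v => WithLp.toLp 2 (G.disagreement v)
      map_add' := fun v w => by
        ext1 i
        simp only [CommGraph.disagreement, PiLp.add_apply, ← Finset.sum_add_distrib, ← smul_add]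
        exact Finset.sum_congr rfl fun j _ => by rw [add_sub_add_comm]
      map_smul' := fun c v => by
        ext1 i
        simp only [CommGraph.disagreement, PiLp.smul_apply, Finset.smul_sum, RingHom.id_apply]
        exact Finset.sum_congr rfl fun j _ => by rw [← smul_sub, smul_comm] }

theorem CommGraph.laplacian_apply (G : CommGraph N) (v : Stack N n) (i : Fin N) :
    G.laplacian n v i = G.disagreement v i := rfl

/-- Exchanging `i` and `j` and using symmetric weights gives the Dirichlet form. Symmetry,
positivity and the kernel of the Laplacian are all read off from it. -/
theorem CommGraph.two_mul_inner_laplacian (G : CommGraph N) (v w : Stack N n) :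
    2 * inner ℝ v (G.laplacian n w)
      = ∑ i, ∑ j, G.weight i j * inner ℝ (v i - v j) (w i - w j) := by
  have h1 : inner ℝ v (G.laplacian n w)
      = ∑ i, ∑ j, G.weight i j * inner ℝ (v i) (w i - w j) := by
    rw [PiLp.inner_apply]
    simp only [G.laplacian_apply, CommGraph.disagreement, inner_sum, real_inner_smul_right]
  have h2 : inner ℝ v (G.laplacian n w)
      = ∑ i, ∑ j, G.weight i j * inner ℝ (v j) (w j - w i) := by
    rw [h1, Finset.sum_comm]
    exact Finset.sum_congr rfl fun i _ => Finset.sum_congr rfl fun j _ => by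
      rw [G.weight_symm]
  rw [two_mul]
  nth_rewrite 1 [h1]
  rw [h2, ← Finset.sum_add_distrib]
  refine Finset.sum_congr rfl fun i _ => ?_
  rw [← Finset.sum_add_distrib]
  refine Finset.sum_congr rfl fun j _ => ?_
  rw [← neg_sub (w i) (w j), inner_neg_right, inner_sub_left]
  ring

theorem CommGraph.weight_nonneg (G : CommGraph N) (i j : Fin N) : 0 ≤ G.weight i j := by
  by_cases h : G.graph.Adj i j
  · exact (G.weight_pos i j h).le
  · exact (G.weight_zero i j h).ge

theorem CommGraph.inner_laplacian_left (G : CommGraph N) (v w : Stack N n) :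
    inner ℝ (G.laplacian n v) w = inner ℝ v (G.laplacian n w) := by
  have h1 := G.two_mul_inner_laplacian v w
  have h2 := G.two_mul_inner_laplacian w v
  rw [real_inner_comm]
  have h3 : ∑ i, ∑ j, G.weight i j * inner ℝ (w i - w j) (v i - v j)
      = ∑ i, ∑ j, G.weight i j * inner ℝ (v i - v j) (w i - w j) :=
    Finset.sum_congr rfl fun i _ => Finset.sum_congr rfl fun j _ => by rw [real_inner_comm]
  linarith

theorem CommGraph.inner_laplacian_nonneg (G : CommGraph N) (v : Stack N n) :
    0 ≤ inner ℝ v (G.laplacian n v) := by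
  have h1 := G.two_mul_inner_laplacian v v
  have h2 : 0 ≤ ∑ i, ∑ j, G.weight i j * inner ℝ (v i - v j) (v i - v j) :=
    Finset.sum_nonneg fun i _ => Finset.sum_nonneg fun j _ =>
      mul_nonneg (G.weight_nonneg i j) real_inner_self_nonneg
  linarith

theorem CommGraph.weight_smul_sub_eq_zero (G : CommGraph N) {v : Stack N n}
    (hv : inner ℝ v (G.laplacian n v) = 0) (i j : Fin N) :
    G.weight i j • (v i - v j) = 0 := by
  have h1 := G.two_mul_inner_laplacian v v
  rw [hv, mul_zero] at h1
  have hnn : ∀ i j, 0 ≤ G.weight i j * inner ℝ (v i - v j) (v i - v j) := fun i j =>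
    mul_nonneg (G.weight_nonneg i j) real_inner_self_nonneg
  have h2 := (Finset.sum_eq_zero_iff_of_nonneg
    (fun i _ => Finset.sum_nonneg fun j _ => hnn i j)).1 h1.symm i (Finset.mem_univ i)
  have h3 := (Finset.sum_eq_zero_iff_of_nonneg (fun j _ => hnn i j)).1 h2 j (Finset.mem_univ j)
  rw [smul_eq_zero]
  exact (mul_eq_zero.1 h3).imp_right fun h => inner_self_eq_zero.1 h

theorem CommGraph.laplacian_eq_zero_of_inner (G : CommGraph N) (v : Stack N n)
    (hv : inner ℝ v (G.laplacian n v) = 0) : G.laplacian n v = 0 := by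
  ext1 i
  rw [G.laplacian_apply]
  exact Finset.sum_eq_zero fun j _ => G.weight_smul_sub_eq_zero hv i j

/-- Zero Dirichlet energy forces equality across every edge, and connectedness propagates it along
walks. -/
theorem CommGraph.laplacian_eq_zero_iff (G : CommGraph N) (v : Stack N n) :
    G.laplacian n v = 0 ↔ ∀ i j, v i = v j := by
  constructor
  · intro hv i j
    have hadj : ∀ i j, G.graph.Adj i j → v i = v j := fun i j h =>
      sub_eq_zero.1 ((smul_eq_zero.1 (G.weight_smul_sub_eq_zero
        (by rw [hv, inner_zero_right]) i j)).resolve_left (G.weight_pos i j h).ne')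
    obtain ⟨p⟩ := G.connected.preconnected i j
    induction p with
    | nil => rfl
    | cons h _ ih => exact (hadj _ _ h).trans ih
  · intro h
    ext1 i
    rw [G.laplacian_apply]
    exact Finset.sum_eq_zero fun j _ => by rw [h i j, sub_self, smul_zero]

/-- Kernel vectors are constant, so pairing with one only sees the sum of the blocks. This turns the
resource constraint into solvability of `L zs = xs - d`. -/
theorem CommGraph.mem_orthogonal_ker_laplacian (G : CommGraph N) {v : Stack N n}
    (hv : ∑ i, v i = 0) : v ∈ (G.laplacian n).kerᗮ := by
  intro w hw
  have hw' := (G.laplacian_eq_zero_iff w).1 hw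
  obtain ⟨i₀⟩ := G.connected.nonempty
  rw [PiLp.inner_apply]
  calc ∑ i, inner ℝ (w i) (v i) = ∑ i, inner ℝ (w i₀) (v i) :=
        Finset.sum_congr rfl fun i _ => by rw [hw' i i₀]
    _ = 0 := by rw [← inner_sum, hv, inner_zero_right]

end Laplacian

/-! ### Strong monotonicity of gradients -/

section Gradient

variable {E : Type*} [NormedAddCommGroup E] [InnerProductSpace ℝ E] [CompleteSpace E]

theorem hasDerivAt_comp_line {f : E → ℝ} (hf : Differentiable ℝ f) (x v : E) (s : ℝ) :
    HasDerivAt (fun s : ℝ => f (x + s • v)) (inner ℝ (gradient f (x + s • v)) v) s := by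
  have h1 : HasDerivAt (fun s : ℝ => x + s • v) v s := by
    simpa using ((hasDerivAt_id s).smul_const v).const_add x
  rw [inner_gradient_left]
  exact (hf _).hasFDerivAt.comp_hasDerivAt s h1

/-- The gradient of a strongly convex function is strongly monotone. -/
theorem StrongConvexOn.inner_gradient_sub_ge {f : E → ℝ} {m : ℝ}
    (hm : StrongConvexOn Set.univ m f) (hf : Differentiable ℝ f) (x y : E) :
    m * ‖y - x‖ ^ 2 ≤ inner ℝ (y - x) (gradient f y - gradient f x) := by
  set v := y - x with hv
  -- Subtracting `m / 2 * ‖·‖ ^ 2` leaves a convex function; along the segment from `x` to `y` its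
  -- derivative at 0 is at most that at 1.
  have hconv := (strongConvexOn_iff_convex.1 hm).comp_affineMap (AffineMap.lineMap x y)
  have hd : ∀ s : ℝ, HasDerivAt
      ((fun z : E => f z - m / 2 * ‖z‖ ^ 2) ∘ (AffineMap.lineMap x y : ℝ →ᵃ[ℝ] E))
      (inner ℝ (gradient f (x + s • v)) v - m * inner ℝ (x + s • v) v) s := by
    intro s
    have h1 : HasDerivAt (fun s : ℝ => x + s • v) v s := by
      simpa using ((hasDerivAt_id s).smul_const v).const_add x
    have h2 := (hasDerivAt_comp_line hf x v s).sub (h1.norm_sq.const_mul (m / 2))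
    convert! h2 using 1
    · funext r
      simp [AffineMap.lineMap_apply, hv, add_comm]
    · ring
  have hmono := hconv.monotoneOn_deriv (fun s _ => (hd s).differentiableAt)
    (Set.mem_univ (0 : ℝ)) (Set.mem_univ (1 : ℝ)) zero_le_one
  rw [(hd 0).deriv, (hd 1).deriv] at hmono
  have hxv : x + v = y := by rw [hv]; abel
  simp only [zero_smul, add_zero, one_smul, hxv] at hmono
  have h3 : inner ℝ y v - inner ℝ x v = ‖v‖ ^ 2 := by
    rw [← inner_sub_left, ← hv, real_inner_self_eq_norm_sq]
  have h4 : m * inner ℝ y v - m * inner ℝ x v = m * ‖v‖ ^ 2 := by rw [← mul_sub, h3]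
  rw [real_inner_comm, inner_sub_left]
  linarith

end Gradient

/-! ### Stacked signals and optimality conditions -/

section Stacking

theorem hasDerivAt_piLp_of_apply {ι W : Type*} [Fintype ι] [NormedAddCommGroup W]
    [NormedSpace ℝ W] {φ : ℝ → PiLp 2 fun _ : ι => W} {φ' : PiLp 2 fun _ : ι => W} {t : ℝ}
    (h : ∀ i, HasDerivAt (fun s => φ s i) (φ' i) t) : HasDerivAt φ φ' t := by
  have h1 : HasDerivAt (fun s => (φ s).ofLp) φ'.ofLp t := hasDerivAt_pi.2 h
  exact (PiLp.continuousLinearEquiv 2 ℝ (fun _ : ι => W)).symm.hasFDerivAt.comp_hasDerivAt t h1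

theorem hasDerivAt_stack {φ : ℝ → Stack N n} {φ' : Stack N n} {t : ℝ}
    (h : ∀ i, HasDerivAt (fun s => φ s i) (φ' i) t) : HasDerivAt φ φ' t :=
  hasDerivAt_piLp_of_apply h

theorem Stack.norm_le_sum (v : Stack N n) : ‖v‖ ≤ ∑ i, ‖v i‖ := by
  refine le_of_sq_le_sq ?_ (Finset.sum_nonneg fun i _ => norm_nonneg _)
  rw [PiLp.norm_sq_eq_of_L2]
  exact Finset.sum_sq_le_sq_sum_of_nonneg fun i _ => norm_nonneg _

/-- Blockwise rate bounds give an ultimate bound on the derivative of the stacked signal. -/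
theorem exists_deriv_of_rateBound {M : ℝ} {φ : ℝ → Stack N n}
    (h : ∀ i, RateBound M (fun t => φ t i)) :
    ∃ φ' : ℝ → Stack N n, (∀ᶠ t in atTop, HasDerivAt φ (φ' t) t) ∧
      ∀ᶠ t in atTop, ‖φ' t‖ ≤ N * |M| := by
  refine ⟨fun t => WithLp.toLp 2 fun i => derivWithin (fun s => φ s i) (Set.Ici 0) t, ?_, ?_⟩
  · filter_upwards [eventually_gt_atTop 0] with t ht
    exact hasDerivAt_stack fun i =>
      ((h i).1 t ht.le).hasDerivWithinAt.hasDerivAt (Ici_mem_nhds ht)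
  · filter_upwards [eventually_all.2 fun i => (h i).2] with t ht
    refine (Stack.norm_le_sum _).trans ?_
    have h1 : ∑ i : Fin N, ‖derivWithin (fun s => φ s i) (Set.Ici 0) t‖ ≤ ∑ _i : Fin N, |M| :=
      Finset.sum_le_sum fun i _ => (ht i).trans (le_abs_self M)
    simpa using h1

/-- The stacked gradient `col(∇f₁(x₁), …, ∇f_N(x_N))`. -/
noncomputable def stackGradient (f : Fin N → Vec n → ℝ) (x : Stack N n) : Stack N n :=
  WithLp.toLp 2 fun i => gradient (f i) (x i)

namespace RegularCosts

variable {f : Fin N → Vec n → ℝ} {l : ℝ≥0}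

theorem differentiable (hf : RegularCosts f l) (i : Fin N) : Differentiable ℝ (f i) :=
  (hf i).1.differentiable one_ne_zero

theorem norm_stackGradient_sub_le (hf : RegularCosts f l) (x y : Stack N n) :
    ‖stackGradient f x - stackGradient f y‖ ≤ l * ‖x - y‖ := by
  refine le_of_sq_le_sq ?_ (by positivity)
  rw [mul_pow, PiLp.norm_sq_eq_of_L2, PiLp.norm_sq_eq_of_L2, Finset.mul_sum]
  refine Finset.sum_le_sum fun i _ => ?_
  rw [← mul_pow]
  exact pow_le_pow_left₀ (norm_nonneg _) ((hf i).2.2.norm_sub_le (x i) (y i)) 2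

theorem exists_stackGradient_strongly_monotone (hf : RegularCosts f l) :
    ∃ μ > 0, ∀ x y : Stack N n,
      μ * ‖x - y‖ ^ 2 ≤ inner ℝ (x - y) (stackGradient f x - stackGradient f y) := by
  choose m hm0 hm using fun i => (hf i).2.1
  obtain ⟨μ, hμ, hle⟩ : ∃ μ > 0, ∀ i, μ ≤ m i := by
    rcases isEmpty_or_nonempty (Fin N) with hN | hN
    · exact ⟨1, one_pos, fun i => hN.elim i⟩
    · obtain ⟨i₀, h₀⟩ := Finite.exists_min m
      exact ⟨m i₀, hm0 i₀, h₀⟩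
  refine ⟨μ, hμ, fun x y => ?_⟩
  rw [PiLp.norm_sq_eq_of_L2, PiLp.inner_apply, Finset.mul_sum]
  refine Finset.sum_le_sum fun i _ => ?_
  have h1 := (hm i).inner_gradient_sub_ge (hf.differentiable i) (y i) (x i)
  have h2 : μ * ‖x i - y i‖ ^ 2 ≤ m i * ‖x i - y i‖ ^ 2 := by gcongr; exact hle i
  exact h2.trans h1

end RegularCosts

/-- At an optimal allocation all marginal costs agree. -/
theorem IsOptimalAllocation.gradient_eq {f : Fin N → Vec n → ℝ} {d Xs : Stack N n}
    (h : IsOptimalAllocation f d Xs) (hf : ∀ i, Differentiable ℝ (f i)) (i j : Fin N) :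
    gradient (f i) (Xs i) = gradient (f j) (Xs j) := by
  rcases eq_or_ne i j with rfl | hij
  · rfl
  set v := gradient (f i) (Xs i) - gradient (f j) (Xs j) with hv
  -- Moving resource from agent `j` to agent `i` preserves the constraint. With `v` the difference
  -- of the marginal costs, the derivative of the total cost in this direction is `‖v‖²`, so it must
  -- vanish.
  set w : Fin N → Vec n := Pi.single i v - Pi.single j v with hw
  have hwsum : ∑ k, w k = 0 := by
    simp [hw, Finset.sum_sub_distrib]
  set φ : ℝ → ℝ := fun s => ∑ k, f k (Xs k + s • w k) with hφ
  have hmin : IsLocalMin φ 0 := by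
    refine Filter.Eventually.of_forall fun s => ?_
    have h1 := h.2 (WithLp.toLp 2 fun k => Xs k + s • w k) (by
      simp only [Finset.sum_add_distrib, ← Finset.smul_sum, hwsum, smul_zero, add_zero]
      exact h.1)
    simpa [hφ] using h1
  have hder : HasDerivAt φ (∑ k, inner ℝ (gradient (f k) (Xs k + (0 : ℝ) • w k)) (w k)) 0 :=
    HasDerivAt.fun_sum fun k _ => hasDerivAt_comp_line (hf k) (Xs k) (w k) 0
  have h0 := hmin.hasDerivAt_eq_zero hder
  have h2 : ∑ k, inner ℝ (gradient (f k) (Xs k + (0 : ℝ) • w k)) (w k) = inner ℝ v v := by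
    have hs : ∀ a k, inner ℝ (gradient (f k) (Xs k)) (Pi.single (M := fun _ => Vec n) a v k)
        = if k = a then inner ℝ (gradient (f a) (Xs a)) v else 0 := by
      intro a k
      by_cases hk : k = a
      · subst hk; simp
      · simp [hk]
    simp only [zero_smul, add_zero, hw, Pi.sub_apply, inner_sub_right, Finset.sum_sub_distrib, hs]
    simp only [Finset.sum_ite_eq', Finset.mem_univ, if_true]
    rw [← inner_sub_left, ← hv]
  rw [h2, inner_self_eq_zero] at h0
  exact sub_eq_zero.1 h0

end Stacking

/-! ### Assembly of the cascade -/

theorem mainTheorem2 (N n : ℕ) (G : CommGraph N) (f : Fin N → Vec n → ℝ) (l : ℝ≥0)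
    (hf : RegularCosts f l) (d Xs : Stack N n) (hXs : IsOptimalAllocation f d Xs)
    (a₁ a₂ : ℝ) (ha₁ : 0 < a₁) (ha₂ : 0 < a₂) (M : ℝ) :
    ∃ C : ℝ, 0 < C ∧
      ∀ (w₀ : ℝ), 0 < w₀ →
      ∀ (g : Fin N → Vec n → Vec n) (A : FDIAttack N n) (S : LoopSignals N n),
        A.Admissible M →
        S.SolvesAlgorithm G f d g A →
        S.SolvesLinearESO G f d a₁ a₂ w₀ →
        (∀ i, RateBound M (fun t => g i (S.x t i))) →
        limsup (fun t => ‖S.x t - Xs‖ₑ) atTop ≤ ENNReal.ofReal (C / w₀) := by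
  set L := G.laplacian n with hL
  obtain ⟨μ, hμ, hmono⟩ := hf.exists_stackGradient_strongly_monotone
  have hgrad : L (stackGradient f Xs) = 0 :=
    (G.laplacian_eq_zero_iff _).2 fun i j => hXs.gradient_eq hf.differentiable i j
  have hfeas : Xs - d ∈ L.kerᗮ := G.mem_orthogonal_ker_laplacian (by
    simp [Finset.sum_sub_distrib, hXs.1])
  obtain ⟨K, hK, hflow⟩ := exists_primalDual_bound L G.inner_laplacian_left
    G.inner_laplacian_nonneg G.laplacian_eq_zero_of_inner hμ l.coe_nonneg (stackGradient f) Xs d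
    (fun x => hmono x Xs) (fun x => hf.norm_stackGradient_sub_le x Xs) hgrad hfeas
  obtain ⟨Ko, hKo, hobs⟩ := exists_observer_bound (E := Stack N n) ha₁ ha₂
  set R : ℝ := N * |M| with hR
  have hR0 : 0 ≤ R := by positivity
  -- One bound for the rates of all three unknown inputs: `2 * R` for the first, at most `2 * (‖L‖ *
  -- R)` for the other two. The `+ 1` keeps it positive, as the observer estimate requires.
  set H : ℝ := 2 * R + 2 * (‖L‖ * R) + 1 with hH
  have hH0 : 0 < H := by positivity
  have hLR : 0 ≤ ‖L‖ * R := by positivity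
  refine ⟨K * (Ko * H), by positivity, fun w₀ hw g A S hA hS hE hg => ?_⟩
  obtain ⟨ua', hua, hua'⟩ := exists_deriv_of_rateBound (φ := A.ua) fun i => (hA i).1.2
  obtain ⟨la', hla, hla'⟩ := exists_deriv_of_rateBound (φ := A.la) fun i => (hA i).2.1.2
  obtain ⟨za', hza, hza'⟩ := exists_deriv_of_rateBound (φ := A.za) fun i => (hA i).2.2.2
  obtain ⟨gx', hgx, hgx'⟩ := exists_deriv_of_rateBound
    (φ := fun t => WithLp.toLp 2 fun i => g i (S.x t i)) hg
  set gx : ℝ → Stack N n := fun t => WithLp.toLp 2 fun i => g i (S.x t i) with hgxdef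
  have hpos := eventually_gt_atTop (0 : ℝ)
  have hLle : ∀ v : Stack N n, ‖v‖ ≤ R → ‖L v‖ ≤ ‖L‖ * R := fun v hv =>
    (L.le_opNorm v).trans (by gcongr)
  have hLd : ∀ {φ : ℝ → Stack N n} {φ' t}, HasDerivAt φ φ' t →
      HasDerivAt (fun s => L (φ s)) (L φ') t := fun h =>
    L.hasFDerivAt.comp_hasDerivAt _ h
  have hx : ∀ᶠ t in atTop, HasDerivAt S.x
      (-stackGradient f (S.x t) - S.lam t + (A.ua t + gx t - S.k1 t)) t := by
    filter_upwards [hpos] with t ht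
    refine hasDerivAt_stack fun i => ?_
    convert! (hS i t ht.le).1.hasDerivAt (Ici_mem_nhds ht) using 1
    simp only [PiLp.add_apply, PiLp.sub_apply, PiLp.neg_apply, hgxdef, stackGradient,
      LoopSignals.input1, FDIAttack.kappa1]
    abel
  have hlam : ∀ᶠ t in atTop, HasDerivAt S.lam
      (-L (S.lam t) - L (S.z t) + S.x t - d + (-L (A.la t) - L (A.za t) - S.k2 t)) t := by
    filter_upwards [hpos] with t ht
    refine hasDerivAt_stack fun i => ?_
    convert! (hS i t ht.le).2.1.hasDerivAt (Ici_mem_nhds ht) using 1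
    simp only [PiLp.add_apply, PiLp.sub_apply, PiLp.neg_apply, hL, G.laplacian_apply,
      LoopSignals.input2, FDIAttack.kappa2]
    abel
  have hz : ∀ᶠ t in atTop, HasDerivAt S.z (L (S.lam t) + (L (A.la t) - S.k3 t)) t := by
    filter_upwards [hpos] with t ht
    refine hasDerivAt_stack fun i => ?_
    convert! (hS i t ht.le).2.2.hasDerivAt (Ici_mem_nhds ht) using 1
    simp only [PiLp.add_apply, PiLp.sub_apply, hL, G.laplacian_apply,
      LoopSignals.input3, FDIAttack.kappa3]
    abel
  have b1 : ∀ᶠ t in atTop, ‖A.ua t + gx t - S.k1 t‖ ≤ Ko * H / w₀ := by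
    refine hobs w₀ H (fun t => S.x t - S.xh t) _ (fun t => ua' t + gx' t) hw hH0 ?_ ?_ ?_
    · filter_upwards [hpos, hx] with t ht hxt
      have hxh : HasDerivAt S.xh (S.k1 t + (-stackGradient f (S.x t) - S.lam t - S.k1 t)
          + a₁ • w₀ • (S.x t - S.xh t)) t := hasDerivAt_stack fun i => by
        convert! (hE i t ht.le).1.hasDerivAt (Ici_mem_nhds ht) using 1
      convert! hxt.sub hxh using 1
      abel
    · filter_upwards [hpos, hua, hgx] with t ht h1 h2
      exact (h1.add h2).sub (hasDerivAt_stack fun i =>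
        (hE i t ht.le).2.2.2.1.hasDerivAt (Ici_mem_nhds ht))
    · filter_upwards [hua', hgx'] with t h1 h2
      have := norm_add_le (ua' t) (gx' t)
      linarith
  have b2 : ∀ᶠ t in atTop, ‖-L (A.la t) - L (A.za t) - S.k2 t‖ ≤ Ko * H / w₀ := by
    refine hobs w₀ H (fun t => S.lam t - S.lamh t) _ (fun t => -L (la' t) - L (za' t)) hw hH0
      ?_ ?_ ?_
    · filter_upwards [hpos, hlam] with t ht hxt
      have hxh : HasDerivAt S.lamh (S.k2 t + (-L (S.lam t) - L (S.z t) + S.x t - d - S.k2 t)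
          + a₁ • w₀ • (S.lam t - S.lamh t)) t := hasDerivAt_stack fun i => by
        convert! (hE i t ht.le).2.1.hasDerivAt (Ici_mem_nhds ht) using 1
      convert! hxt.sub hxh using 1
      abel
    · filter_upwards [hpos, hla, hza] with t ht h1 h2
      exact ((hLd h1).neg.sub (hLd h2)).sub (hasDerivAt_stack fun i =>
        (hE i t ht.le).2.2.2.2.1.hasDerivAt (Ici_mem_nhds ht))
    · filter_upwards [hla', hza'] with t h1 h2
      have h3 := norm_sub_le (-L (la' t)) (L (za' t))
      rw [norm_neg] at h3
      have := hLle _ h1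
      have := hLle _ h2
      linarith
  have b3 : ∀ᶠ t in atTop, ‖L (A.la t) - S.k3 t‖ ≤ Ko * H / w₀ := by
    refine hobs w₀ H (fun t => S.z t - S.zh t) _ (fun t => L (la' t)) hw hH0 ?_ ?_ ?_
    · filter_upwards [hpos, hz] with t ht hxt
      have hxh : HasDerivAt S.zh (S.k3 t + (L (S.lam t) - S.k3 t)
          + a₁ • w₀ • (S.z t - S.zh t)) t := hasDerivAt_stack fun i => by
        convert! (hE i t ht.le).2.2.1.hasDerivAt (Ici_mem_nhds ht) using 1
      convert! hxt.sub hxh using 1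
      abel
    · filter_upwards [hpos, hla] with t ht h1
      exact (hLd h1).sub (hasDerivAt_stack fun i =>
        (hE i t ht.le).2.2.2.2.2.hasDerivAt (Ici_mem_nhds ht))
    · filter_upwards [hla'] with t h1
      have := hLle _ h1
      linarith
  have hfinal := hflow S.x S.lam S.z _ _ _ (Ko * H / w₀) (by positivity) hx hlam hz
    (b1.and (b2.and b3))
  -- The limsup is taken in `ℝ≥0∞`, so an eventual bound suffices, with no separate boundedness to
  -- check.
  refine limsup_le_of_le (by isBoundedDefault) ?_
  filter_upwards [hfinal] with t ht
  rw [← ofReal_norm]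
  refine ENNReal.ofReal_le_ofReal (ht.trans_eq ?_)
  ring

end Instances
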